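/- Let $1\le d\le n$ and $1\le k\le n$ be integers, let $\lambda>0$, and let $a_1,\dots,a_n\in\mathbb R^d$. Put $\tilde k=\min\{k,d\}$ and $P=\{x\in[0,1]^n:\sum_{i=1}^n x_i=k\}$. Let $A\in\mathbb R^{d\times n}$ be the matrix with columns $a_i$, let $C=A^\top A+\lambda I_n$, and let $H\in\mathbb R^{n\times n}$, with columns $h_1,\dots,h_n$, satisfy $C=H^\top H$ (for instance a Cholesky factor of $C$). For a positive semidefinite $X\in\mathbb R^{d\times d}$ with eigenvalues $\sigma_1\ge\cdots\ge\sigma_d\ge0$ let $\Gamma(X;\lambda)=\sum_{i=1}^{\tilde k}\frac1{\sigma_i+\lambda}$, and let $\operatorname{conv}\Gamma(\cdot;\lambda)$ be its convex envelope, i.e. the pointwise largest convex function on the cone of positive semidefinite $d\times d$ matrices that is bounded above by $\Gamma(\cdot;\lambda)$. For a positive semidefinite $Y\in\mathbb R^{n\times n}$ of rank at least $k$ with eigenvalues $\beta_1\ge\cdots\ge\beta_n\ge0$ let $$\Phi(Y)=\sum_{i=1}^{\iota}\frac1{\beta_i}+\frac{(k-\iota)^2}{\sum_{i=\iota+1}^n\beta_i},$$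 where $\iota$ is the unique integer with $0\le\iota\le k-1$ and $\beta_\iota>\frac1{k-\iota}\sum_{i=\iota+1}^n\beta_i\ge\beta_{\iota+1}$, with the convention $\beta_0=\infty$. Define $$\nu^C_k=\min_{x\in P}\operatorname{tr}\Big(\Big(\sum_{i=1}^n x_ia_ia_i^\top+\lambda I_d\Big)^{-1}\Big),$$ $$\nu^N_k=\min_{x\in P}\Big\{\operatorname{conv}\Gamma\Big(\sum_{i=1}^n x_ia_ia_i^\top;\lambda\Big)+\frac{d-\tilde k}{\lambda}\Big\},$$ $$\nu^M_k=\min_{x\in P}\Big\{\Phi\Big(\sum_{i=1}^n x_ih_ih_i^\top\Big)+\frac{d-k}{\lambda}\Big\}.$$ Then these minima are attained, and (i) $\nu^N_k=\nu^C_k$ if $d\le k\le n$; (ii) $\nu^N_k\ge\nu^C_k$ if $1\le k\le d-1$; (iii) $\nu^N_k\ge\nu^M_k$ for every $1\le k\le n$. -/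

import Mathlib

namespace RAOD

/-- The eigenvalues of a real symmetric `m × m` matrix, listed with multiplicity in nonincreasing
order and indexed from `0`: `eig X 0 ≥ eig X 1 ≥ ⋯ ≥ eig X (m - 1)`.
The value is `0` for an index `≥ m` or a matrix that is not symmetric. -/
noncomputable def eig {m : ℕ} (X : Matrix (Fin m) (Fin m) ℝ) (i : ℕ) : ℝ :=
  open Classical in
  if h : X.IsHermitian ∧ i < m then
    h.1.eigenvalues₀ ⟨i, h.2.trans_eq (Fintype.card_fin m).symm⟩
  else 0

/-- The cone of positive semidefinite real symmetric `m × m` matrices. -/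
def psdCone (m : ℕ) : Set (Matrix (Fin m) (Fin m) ℝ) := {X | X.PosSemidef}

/-- The convex envelope of `f` on `s`, i.e. the pointwise supremum of all functions that are
convex on `s` and bounded above by `f` on `s`. -/
noncomputable def convEnvelope {E : Type*} [AddCommGroup E] [Module ℝ E]
    (s : Set E) (f : E → ℝ) (x : E) : ℝ :=
  sSup {y : ℝ | ∃ g : E → ℝ, ConvexOn ℝ s g ∧ (∀ z ∈ s, g z ≤ f z) ∧ y = g x}

/-- `Γ(X; λ) = ∑_{i ≤ min(k, d)} 1 / (σ_i + λ)`, with `σ_1 ≥ ⋯ ≥ σ_d` the eigenvalues of `X`. -/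
noncomputable def Gam {d : ℕ} (k : ℕ) (lam : ℝ) (X : Matrix (Fin d) (Fin d) ℝ) : ℝ :=
  ∑ i ∈ Finset.range (min k d), 1 / (eig X i + lam)

/-- The convex envelope of `Γ(·; λ)` on the positive semidefinite cone. -/
noncomputable def convGam {d : ℕ} (k : ℕ) (lam : ℝ) (X : Matrix (Fin d) (Fin d) ℝ) : ℝ :=
  convEnvelope (psdCone d) (Gam k lam) X

/-- For `β_1 ≥ ⋯ ≥ β_n` (here `β_j` is `β (j - 1)`), the property
`β_ι > (1 / (k - ι)) ∑_{i = ι + 1}^n β_i ≥ β_{ι + 1}` of an integer `0 ≤ ι ≤ k - 1`,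
where `β_0 = ∞`. -/
def IsIota (n k : ℕ) (β : ℕ → ℝ) (ι : ℕ) : Prop :=
  ι < k ∧
  (ι = 0 ∨ (1 / ((k : ℝ) - ι)) * ∑ i ∈ Finset.Ico ι n, β i < β (ι - 1)) ∧
  β ι ≤ (1 / ((k : ℝ) - ι)) * ∑ i ∈ Finset.Ico ι n, β i

/-- The integer of `IsIota`. -/
noncomputable def iota (n k : ℕ) (β : ℕ → ℝ) : ℕ := sInf {ι | IsIota n k β ι}

/-- There is exactly one integer as in `IsIota` if the `β_i` are nonnegative and nonincreasing. -/
theorem existsUnique_isIota {n k : ℕ} (hk : 1 ≤ k) (hkn : k ≤ n) (β : ℕ → ℝ)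
    (hβ : ∀ i j, i ≤ j → j < n → β j ≤ β i) (h0 : ∀ i, 0 ≤ β i) :
    ∃! ι, IsIota n k β ι := by
  classical
  -- the two inequalities with the denominator cleared
  have key : ∀ ι, IsIota n k β ι ↔ ι < k ∧
      (ι = 0 ∨ ∑ i ∈ Finset.Ico ι n, β i < ((k : ℝ) - ι) * β (ι - 1)) ∧
      ((k : ℝ) - ι) * β ι ≤ ∑ i ∈ Finset.Ico ι n, β i := by
    intro ι
    unfold IsIota
    refine and_congr_right fun h => ?_
    have hp : (0 : ℝ) < (k : ℝ) - ι := by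
      have : (ι : ℝ) < k := by exact_mod_cast h
      linarith
    rw [one_div_mul_eq_div, div_lt_iff₀ hp, le_div_iff₀ hp, mul_comm (β (ι - 1)), mul_comm (β ι)]
  have hS : ∀ ι, ι < n →
      ∑ i ∈ Finset.Ico ι n, β i = β ι + ∑ i ∈ Finset.Ico (ι + 1) n, β i :=
    fun ι h => Finset.sum_eq_sum_Ico_succ_bot h β
  -- `P ι` is the second inequality
  let P : ℕ → Prop := fun ι => ((k : ℝ) - ι) * β ι ≤ ∑ i ∈ Finset.Ico ι n, β i
  have hex : ∃ ι, P ι := by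
    refine ⟨k - 1, ?_⟩
    have h1 : ((k : ℝ) - ((k - 1 : ℕ) : ℝ)) = 1 := by
      rw [Nat.cast_sub hk]; simp
    show _ ≤ _
    rw [h1, one_mul, hS (k - 1) (by omega)]
    have := Finset.sum_nonneg (s := Finset.Ico (k - 1 + 1) n) (f := β) fun i _ => h0 i
    linarith
  have hstep : ∀ j, j + 1 < n → P j → P (j + 1) := by
    intro j hj h
    have hb := hβ j (j + 1) (by omega) hj
    have h' : ((k : ℝ) - j) * β j ≤ ∑ i ∈ Finset.Ico j n, β i := h
    rw [hS j (by omega)] at h'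
    show ((k : ℝ) - ((j + 1 : ℕ) : ℝ)) * β (j + 1) ≤ _
    push_cast
    have hs := Finset.sum_nonneg (s := Finset.Ico (j + 1) n) (f := β) fun i _ => h0 i
    rcases le_or_gt 0 ((k : ℝ) - (j + 1)) with hc | hc
    · nlinarith [mul_le_mul_of_nonneg_left hb hc]
    · nlinarith [mul_nonneg_of_nonpos_of_nonpos hc.le (neg_nonpos.2 (h0 (j + 1)))]
  have hlt : Nat.find hex < k := by
    have : Nat.find hex ≤ k - 1 := by
      refine Nat.find_min' hex ?_
      show ((k : ℝ) - ((k - 1 : ℕ) : ℝ)) * _ ≤ _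
      have h1 : ((k : ℝ) - ((k - 1 : ℕ) : ℝ)) = 1 := by
        rw [Nat.cast_sub hk]; simp
      rw [h1, one_mul, hS (k - 1) (by omega)]
      have := Finset.sum_nonneg (s := Finset.Ico (k - 1 + 1) n) (f := β) fun i _ => h0 i
      linarith
    omega
  -- the first inequality at `j + 1` is the failure of `P` at `j`
  have hfirst : ∀ j, j < n →
      (∑ i ∈ Finset.Ico (j + 1) n, β i < ((k : ℝ) - ((j + 1 : ℕ) : ℝ)) * β j ↔ ¬ P j) := by
    intro j hj
    show _ ↔ ¬ (((k : ℝ) - j) * β j ≤ ∑ i ∈ Finset.Ico j n, β i)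
    rw [not_le, hS j hj]
    push_cast
    constructor <;> intro h <;> nlinarith
  refine ⟨Nat.find hex, (key _).2 ⟨hlt, ?_, Nat.find_spec hex⟩, ?_⟩
  · rcases h : Nat.find hex with _ | j
    · exact Or.inl rfl
    · right
      exact (hfirst j (by omega)).2 (Nat.find_min hex (by omega))
  · intro ι hι
    obtain ⟨h1, h2, h3⟩ := (key ι).1 hι
    refine le_antisymm ?_ (Nat.find_min' hex h3)
    rcases ι with _ | j
    · exact Nat.zero_le _
    · rcases h2 with h2 | h2
      · omega
      · have hnp := (hfirst j (by omega)).1 h2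
        by_contra hcon
        have hle : Nat.find hex ≤ j := by omega
        refine hnp (Nat.le_induction (P := fun i _ => i < n → P i)
          (fun _ => Nat.find_spec hex) ?_ j hle (by omega))
        intro i _ ih hi
        exact hstep i hi (ih (by omega))

/-- `φ(β) = ∑_{i ≤ ι} 1 / β_i + (k - ι)² / ∑_{i = ι + 1}^n β_i`. -/
noncomputable def phi (n k : ℕ) (β : ℕ → ℝ) : ℝ :=
  ∑ i ∈ Finset.range (iota n k β), 1 / β i +
    ((k : ℝ) - iota n k β) ^ 2 / ∑ i ∈ Finset.Ico (iota n k β) n, β i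

/-- `Φ(Y) = φ(β)`, with `β_1 ≥ ⋯ ≥ β_n` the eigenvalues of `Y`. -/
noncomputable def Phi {n : ℕ} (k : ℕ) (Y : Matrix (Fin n) (Fin n) ℝ) : ℝ :=
  phi n k (eig Y)

/-- `∑_i x_i v_i v_iᵀ`. -/
def wsum {n m : ℕ} (v : Fin n → Fin m → ℝ) (x : Fin n → ℝ) : Matrix (Fin m) (Fin m) ℝ :=
  ∑ i, x i • Matrix.vecMulVec (v i) (v i)

/-- The feasible set `{x ∈ [0,1]^n : ∑_i x_i = k}`. -/
def feasible (n k : ℕ) : Set (Fin n → ℝ) :=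
  {x | (∀ i, 0 ≤ x i ∧ x i ≤ 1) ∧ ∑ i, x i = (k : ℝ)}

/-- The `d × n` matrix with columns `a_1, …, a_n`. -/
def colMatrix {d n : ℕ} (a : Fin n → Fin d → ℝ) : Matrix (Fin d) (Fin n) ℝ :=
  Matrix.of fun r i => a i r

/-- `C = Aᵀ A + λ I_n`, with `A` the matrix with columns `a_1, …, a_n`. -/
def covMatrix {d n : ℕ} (a : Fin n → Fin d → ℝ) (lam : ℝ) : Matrix (Fin n) (Fin n) ℝ :=
  (colMatrix a).transpose * colMatrix a + lam • (1 : Matrix (Fin n) (Fin n) ℝ)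

/-- Objective of the conventional relaxation: `tr((∑_i x_i a_i a_iᵀ + λ I_d)⁻¹)`. -/
noncomputable def objC {d n : ℕ} (a : Fin n → Fin d → ℝ) (lam : ℝ) (x : Fin n → ℝ) : ℝ :=
  ((wsum a x + lam • (1 : Matrix (Fin d) (Fin d) ℝ))⁻¹).trace

/-- Objective of the new relaxation: `conv Γ(∑_i x_i a_i a_iᵀ; λ) + (d - min(k, d)) / λ`. -/
noncomputable def objN {d n : ℕ} (a : Fin n → Fin d → ℝ) (lam : ℝ) (k : ℕ)
    (x : Fin n → ℝ) : ℝ :=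
  convGam k lam (wsum a x) + ((d : ℝ) - (min k d : ℕ)) / lam

/-- Objective of the relaxation through the factor `H` of `C = Hᵀ H`, whose columns are
`h_1, …, h_n`: `Φ(∑_i x_i h_i h_iᵀ) + (d - k) / λ`. -/
noncomputable def objM {n : ℕ} (d : ℕ) (H : Matrix (Fin n) (Fin n) ℝ) (lam : ℝ) (k : ℕ)
    (x : Fin n → ℝ) : ℝ :=
  Phi k (wsum (fun i j => H j i) x) + ((d : ℝ) - k) / lam

/-- The value `ν^C_k` of the conventional relaxation. -/
noncomputable def nuC {d n : ℕ} (a : Fin n → Fin d → ℝ) (lam : ℝ) (k : ℕ) : ℝ :=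
  sInf (objC a lam '' feasible n k)

/-- The value `ν^N_k` of the new relaxation. -/
noncomputable def nuN {d n : ℕ} (a : Fin n → Fin d → ℝ) (lam : ℝ) (k : ℕ) : ℝ :=
  sInf (objN a lam k '' feasible n k)

/-- The value `ν^M_k` of the relaxation through the factor `H`. -/
noncomputable def nuM {n : ℕ} (d : ℕ) (H : Matrix (Fin n) (Fin n) ℝ) (lam : ℝ) (k : ℕ) : ℝ :=
  sInf (objM d H lam k '' feasible n k)

end RAOD

namespace RAOD

/-! All three objectives are, up to constants, one function of a spectrum. Given β and k, keep β_1,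
…, β_ι and replace the tail by k - ι equal entries with the same total. This is μ = `spread`, and
`spreadSum` is Σ_{i ≤ k} 1/(μ_i + λ). On the spectrum of Σ x_i a_i a_iᵀ it is the trace objective
when k is replaced by d, and the convex envelope when k is replaced by min(k, d); on that of Σ x_i
h_i h_iᵀ, with λ = 0, it is Φ.

Supporting functionals carry the argument. Since μ is nonincreasing, the slopes w_i = 1/(μ_i + λ)²
are nondecreasing. For such weights, the ordered eigenvalues of Y have weighted sum at most that of
the diagonal of QᵀYQ for any orthogonal Q (`sum_mul_eig_le`), and spreading lowers it further
(`sum_mul_spread_le`). Tangents of 1/t at μ_i + λ then give an affine minorant touching `spreadSum`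
at the chosen matrix. Hence convexity, lower semicontinuity, and attained minima.

For the envelope, β ≤ μ puts `spreadSum` below Γ. Conversely β = μp with p in the hypersimplex of
total min(k, d). Birkhoff's theorem writes p as a convex combination of 0/1 vertices, at each of
which Γ is at most the matching partial sum of 1/(μ_i + λ); so no convex minorant of Γ exceeds
`spreadSum`.

In (i) the objectives coincide. In (ii) the trace objective minus a constant is itself a convex
minorant of Γ. In (iii) the inequality holds at each x: with S = diag(√x), Σ x_i h_i h_iᵀ has the
spectrum of SAᵀAS + λ diag(x), and this bound enters the supporting functional of Φ. -/

/-! ### Ordered eigenvalues -/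

open Matrix in
theorem exists_orthogonal_diagonalization {m : ℕ} {X : Matrix (Fin m) (Fin m) ℝ}
    (hX : X.IsHermitian) :
    ∃ Q : Matrix (Fin m) (Fin m) ℝ, Qᵀ * Q = 1 ∧
      X = Q * diagonal (fun i : Fin m => eig X i) * Qᵀ := by
  classical
  -- `eigenvalues` is `eigenvalues₀` reindexed through an arbitrary equivalence; `e` undoes that
  -- reindexing.
  let e : Fin m ≃ Fin m :=
    (finCongr (Fintype.card_fin m).symm).trans
      (Fintype.equivOfCardEq (Fintype.card_fin (Fintype.card (Fin m))))
  have he : ∀ i : Fin m, hX.eigenvalues (e i) = eig X i := by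
    intro i
    have h : X.IsHermitian ∧ (i : ℕ) < m := ⟨hX, i.2⟩
    rw [eig, dif_pos h, IsHermitian.eigenvalues]
    simp only [e, Equiv.trans_apply, Equiv.symm_apply_apply]
    rfl
  let U : Matrix (Fin m) (Fin m) ℝ := hX.eigenvectorUnitary
  have hU : Uᵀ * U = 1 := by
    have := Unitary.coe_star_mul_self hX.eigenvectorUnitary
    simpa [star_eq_conjTranspose] using this
  have hs : X = U * diagonal hX.eigenvalues * Uᵀ := by
    have := hX.spectral_theorem
    rw [Unitary.conjStarAlgAut_apply] at this
    simpa [star_eq_conjTranspose, Function.comp_def] using this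
  refine ⟨U.submatrix id e, ?_, ?_⟩
  · rw [transpose_submatrix, ← submatrix_mul _ _ _ id _ Function.bijective_id, hU]
    exact submatrix_one_equiv e
  · have hd : diagonal (fun i : Fin m => eig X i) = (diagonal hX.eigenvalues).submatrix e e := by
      rw [submatrix_diagonal_equiv]
      congr 1
      funext i
      exact (he i).symm
    rw [hd, transpose_submatrix, submatrix_mul_equiv, submatrix_mul_equiv, submatrix_id_id]
    exact hs

theorem eig_antitone {m : ℕ} (X : Matrix (Fin m) (Fin m) ℝ) {i j : ℕ} (hij : i ≤ j)
    (hj : j < m) : eig X j ≤ eig X i := by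
  by_cases hX : X.IsHermitian
  · rw [eig, eig, dif_pos ⟨hX, hj⟩, dif_pos ⟨hX, hij.trans_lt hj⟩]
    exact hX.eigenvalues₀_antitone hij
  · rw [eig, eig, dif_neg (fun h => hX h.1), dif_neg (fun h => hX h.1)]

theorem eig_of_le {m : ℕ} (X : Matrix (Fin m) (Fin m) ℝ) {i : ℕ} (hi : m ≤ i) : eig X i = 0 := by
  rw [eig, dif_neg]
  exact fun h => absurd h.2 (by omega)

open Matrix in
theorem diag_conj_nonneg {m : ℕ} {X : Matrix (Fin m) (Fin m) ℝ} (hX : X.PosSemidef)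
    (Q : Matrix (Fin m) (Fin m) ℝ) (i : Fin m) : 0 ≤ (Qᵀ * X * Q) i i := by
  have := (hX.conjTranspose_mul_mul_same Q).diag_nonneg (i := i)
  simpa using this

open Matrix in
theorem eig_eq_diag_conj {m : ℕ} {X Q : Matrix (Fin m) (Fin m) ℝ} (hQ : Qᵀ * Q = 1)
    (h : X = Q * diagonal (fun i : Fin m => eig X i) * Qᵀ) (i : Fin m) :
    (Qᵀ * X * Q) i i = eig X i := by
  have : Qᵀ * X * Q = diagonal (fun i : Fin m => eig X i) := by
    conv_lhs => rw [h]
    calc _ = (Qᵀ * Q) * diagonal (fun i : Fin m => eig X i) * (Qᵀ * Q) := by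
          simp only [Matrix.mul_assoc]
      _ = _ := by simp [hQ]
  rw [this, diagonal_apply_eq]

theorem eig_nonneg {m : ℕ} {X : Matrix (Fin m) (Fin m) ℝ} (hX : X.PosSemidef) (i : ℕ) :
    0 ≤ eig X i := by
  rcases lt_or_ge i m with hi | hi
  · obtain ⟨Q, hQ, h⟩ := exists_orthogonal_diagonalization hX.1
    have := eig_eq_diag_conj hQ h ⟨i, hi⟩
    rw [← show eig X ((⟨i, hi⟩ : Fin m) : ℕ) = eig X i from rfl, ← this]
    exact diag_conj_nonneg hX Q _
  · rw [eig_of_le X hi]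

open Matrix Polynomial in
theorem charpoly_conj_diagonal {m : ℕ} {Q : Matrix (Fin m) (Fin m) ℝ} (hQ : Qᵀ * Q = 1)
    (v : Fin m → ℝ) : (Q * diagonal v * Qᵀ).charpoly = ∏ i, (X - C (v i)) := by
  rw [charpoly_mul_comm, ← Matrix.mul_assoc, hQ, Matrix.one_mul, charpoly_diagonal]

open Polynomial in
theorem charpoly_eq_prod_eig {m : ℕ} {Y : Matrix (Fin m) (Fin m) ℝ} (hY : Y.IsHermitian) :
    Y.charpoly = ∏ i : Fin m, (X - C (eig Y i)) := by
  obtain ⟨Q, hQ, h⟩ := exists_orthogonal_diagonalization hY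
  conv_lhs => rw [h]
  exact charpoly_conj_diagonal hQ _

/-- Equal products have equal root multisets, so the two families agree once each is sorted. -/
theorem exists_perm_of_prod_eq {m : ℕ} {u v : Fin m → ℝ}
    (h : ∏ i, (Polynomial.X - Polynomial.C (u i)) = ∏ i, (Polynomial.X - Polynomial.C (v i))) :
    ∃ τ : Equiv.Perm (Fin m), u = v ∘ τ := by
  have hr : ∀ w : Fin m → ℝ, (∏ i, (Polynomial.X - Polynomial.C (w i))).roots =
      Multiset.map w Finset.univ.val := by
    intro w
    rw [Polynomial.roots_prod]
    · simp
    · simp [Finset.prod_ne_zero_iff, Polynomial.X_sub_C_ne_zero]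
  have h2 : Multiset.map u Finset.univ.val = Multiset.map v Finset.univ.val := by
    rw [← hr, ← hr, h]
  rw [Fin.univ_val_map, Fin.univ_val_map, Multiset.coe_eq_coe] at h2
  have h3 : List.ofFn (u ∘ Tuple.sort u) = List.ofFn (v ∘ Tuple.sort v) :=
    (((Tuple.sort u).ofFn_comp_perm u).trans
      (h2.trans ((Tuple.sort v).ofFn_comp_perm v).symm)).eq_of_sortedLE
      (Tuple.monotone_sort u).sortedLE_ofFn (Tuple.monotone_sort v).sortedLE_ofFn
  have h4 := List.ofFn_injective h3
  refine ⟨(Tuple.sort u).symm.trans (Tuple.sort v), ?_⟩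
  funext i
  have := congrFun h4 ((Tuple.sort u).symm i)
  simpa using this

theorem exists_perm_eig_eq {m : ℕ} {Y : Matrix (Fin m) (Fin m) ℝ} (hY : Y.IsHermitian)
    {v : Fin m → ℝ} (h : Y.charpoly = ∏ i, (Polynomial.X - Polynomial.C (v i))) :
    ∃ τ : Equiv.Perm (Fin m), ∀ i : Fin m, eig Y i = v (τ i) := by
  obtain ⟨τ, hτ⟩ := exists_perm_of_prod_eq ((charpoly_eq_prod_eig hY).symm.trans h)
  exact ⟨τ, fun i => congrFun hτ i⟩

theorem eig_eq_of_charpoly {m : ℕ} {Y : Matrix (Fin m) (Fin m) ℝ} (hY : Y.IsHermitian)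
    {v : Fin m → ℝ} (hv : Antitone v)
    (h : Y.charpoly = ∏ i, (Polynomial.X - Polynomial.C (v i))) (i : Fin m) : eig Y i = v i := by
  obtain ⟨τ, hτ⟩ := exists_perm_eig_eq hY h
  have ha : Antitone (v ∘ τ) := by
    intro i j hij
    simp only [Function.comp_apply, ← hτ]
    exact eig_antitone Y hij j.2
  have := Tuple.unique_antitone (f := v) (σ := τ) (τ := Equiv.refl _) ha hv
  rw [hτ]
  exact congrFun this i

open Matrix in
/-- The nonzero spectra of `ZᵀZ` and `ZZᵀ` agree. -/
theorem eig_transpose_mul_self {d n : ℕ} (hdn : d ≤ n) (Z : Matrix (Fin d) (Fin n) ℝ) {i : ℕ}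
    (hi : i < n) : eig (Zᵀ * Z) i = eig (Z * Zᵀ) i := by
  have h1 : (Zᵀ * Z).PosSemidef := by simpa using posSemidef_conjTranspose_mul_self Z
  have h2 : (Z * Zᵀ).PosSemidef := by simpa using posSemidef_self_mul_conjTranspose Z
  refine eig_eq_of_charpoly h1.1 (v := fun j : Fin n => eig (Z * Zᵀ) j) ?_ ?_ ⟨i, hi⟩
  · intro j l hjl
    rcases lt_or_ge (l : ℕ) d with hl | hl
    · exact eig_antitone _ hjl hl
    · simpa only [eig_of_le _ hl] using eig_nonneg h2 j
  · rw [charpoly_mul_comm_of_le _ _ (by simpa using hdn), charpoly_eq_prod_eig h2.1]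
    obtain ⟨e, rfl⟩ := Nat.exists_eq_add_of_le hdn
    rw [Fin.prod_univ_add]
    simp [eig_of_le, mul_comm]

/-! ### Weighted sums with monotone weights -/

/-- Averaging by a doubly stochastic matrix can only increase the pairing of a monotone and an
antitone sequence. -/
theorem sum_mul_le_sum_mulVec_of_antivary {ι : Type*} [Fintype ι] [DecidableEq ι] {w s : ι → ℝ}
    (h : Antivary w s) {M : Matrix ι ι ℝ} (hM : M ∈ doublyStochastic ℝ ι) :
    ∑ i, w i * s i ≤ ∑ i, w i * ∑ j, M i j * s j := by
  obtain ⟨c, hc0, hc1, rfl⟩ := exists_eq_sum_perm_of_mem_doublyStochastic hM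
  have key : ∀ σ : Equiv.Perm ι, ∑ i, w i * ∑ j, (σ.permMatrix ℝ) i j * s j =
      ∑ i, w i * s (σ i) := by
    intro σ
    simp [Equiv.Perm.permMatrix, PEquiv.toMatrix_apply, Equiv.toPEquiv_apply]
  have : ∑ i, w i * ∑ j, (∑ σ, c σ • σ.permMatrix ℝ) i j * s j =
      ∑ σ, c σ * ∑ i, w i * s (σ i) := by
    simp only [← key, Matrix.sum_apply, Matrix.smul_apply, smul_eq_mul, Finset.sum_mul,
      Finset.mul_sum]
    rw [Finset.sum_comm]
    rw [Finset.sum_comm (s := Finset.univ (α := Equiv.Perm ι))]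
    rw [Finset.sum_comm]
    refine Finset.sum_congr rfl fun i _ => ?_
    rw [Finset.sum_comm]
    refine Finset.sum_congr rfl fun j _ => Finset.sum_congr rfl fun σ _ => by ring
  rw [this]
  calc ∑ i, w i * s i = ∑ σ, c σ * ∑ i, w i * s i := by rw [← Finset.sum_mul, hc1, one_mul]
    _ ≤ _ := Finset.sum_le_sum fun σ _ => mul_le_mul_of_nonneg_left
      (by simpa using h.sum_smul_le_sum_smul_comp_perm (σ := σ)) (hc0 σ)

open Matrix in
theorem sq_mem_doublyStochastic {m : ℕ} {R : Matrix (Fin m) (Fin m) ℝ} (hR : Rᵀ * R = 1) :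
    (Matrix.of fun i j => R i j ^ 2) ∈ doublyStochastic ℝ (Fin m) := by
  have hR' : R * Rᵀ = 1 := mul_eq_one_comm.1 hR
  rw [mem_doublyStochastic_iff_sum]
  refine ⟨fun i j => sq_nonneg _, fun i => ?_, fun j => ?_⟩
  · have := congrFun (congrFun hR' i) i
    simpa [Matrix.mul_apply, sq] using this
  · have := congrFun (congrFun hR j) j
    simpa [Matrix.mul_apply, sq] using this

/-- For monotone weights, the weighted sum of the ordered eigenvalues is at most the weighted sum
of the diagonal in any orthonormal basis. -/
theorem sum_mul_eig_le {m : ℕ} {Y Q : Matrix (Fin m) (Fin m) ℝ} (hY : Y.IsHermitian)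
    (hQ : Q.transpose * Q = 1) {w : ℕ → ℝ} (hw : Monotone w) :
    ∑ i : Fin m, w i * eig Y i ≤ ∑ i : Fin m, w i * (Q.transpose * Y * Q) i i := by
  obtain ⟨V, hV, h⟩ := exists_orthogonal_diagonalization hY
  have hV' : V * V.transpose = 1 := mul_eq_one_comm.1 hV
  set R := Q.transpose * V with hRdef
  have hQ' : Q * Q.transpose = 1 := mul_eq_one_comm.1 hQ
  have hR : R.transpose * R = 1 := by
    rw [hRdef, Matrix.transpose_mul, Matrix.transpose_transpose]
    calc _ = V.transpose * (Q * Q.transpose) * V := by simp only [Matrix.mul_assoc]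
      _ = 1 := by rw [hQ', Matrix.mul_one, hV]
  have hd : ∀ i, (Q.transpose * Y * Q) i i = ∑ j : Fin m, R i j ^ 2 * eig Y j := by
    intro i
    have : Q.transpose * Y * Q = R * Matrix.diagonal (fun i : Fin m => eig Y i) * R.transpose := by
      conv_lhs => rw [h]
      simp only [hRdef, Matrix.transpose_mul, Matrix.transpose_transpose, Matrix.mul_assoc]
    rw [this, Matrix.mul_apply]
    refine Finset.sum_congr rfl fun j _ => ?_
    rw [Matrix.mul_diagonal, Matrix.transpose_apply]
    ring
  simp only [hd]
  refine sum_mul_le_sum_mulVec_of_antivary (w := fun i : Fin m => w i)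
    (s := fun i : Fin m => eig Y i) ?_ (sq_mem_doublyStochastic hR)
  intro i j hij
  have : ¬ (i ≤ j) := fun hle => absurd (eig_antitone Y hle j.2) (not_le.2 hij)
  exact hw (by exact_mod_cast (not_le.1 this).le)

/-- A sequence that is below `z` on the first `k` indices and nonnegative afterwards, with the same
total, has the larger weighted sum for monotone weights. -/
theorem sum_mul_le_sum_mul_of_crossing {m k : ℕ} (hkm : k ≤ m) {w y z : ℕ → ℝ} (hw : Monotone w)
    (h1 : ∀ i < k, y i ≤ z i) (h2 : ∀ i, k ≤ i → i < m → 0 ≤ y i)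
    (h : ∑ i ∈ Finset.range m, y i = ∑ i ∈ Finset.range k, z i) :
    ∑ i ∈ Finset.range k, w i * z i ≤ ∑ i ∈ Finset.range m, w i * y i := by
  rw [← Finset.sum_range_add_sum_Ico _ hkm] at h ⊢
  -- The difference of the two sequences is nonpositive before `k` and nonnegative after, so every
  -- weight can be compared with the pivot `w k`; the pivot terms cancel by equality of totals.
  have e1 : ∑ i ∈ Finset.range k, w k * (y i - z i) ≤
      ∑ i ∈ Finset.range k, w i * (y i - z i) := by
    refine Finset.sum_le_sum fun i hi => ?_
    have hi' := Finset.mem_range.1 hi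
    exact mul_le_mul_of_nonpos_right (hw hi'.le) (sub_nonpos.2 (h1 i hi'))
  have e2 : ∑ i ∈ Finset.Ico k m, w k * y i ≤ ∑ i ∈ Finset.Ico k m, w i * y i := by
    refine Finset.sum_le_sum fun i hi => ?_
    obtain ⟨hi1, hi2⟩ := Finset.mem_Ico.1 hi
    exact mul_le_mul_of_nonneg_right (hw hi1) (h2 i hi1 hi2)
  have e3 : w k * ((∑ i ∈ Finset.range k, y i + ∑ i ∈ Finset.Ico k m, y i) -
      ∑ i ∈ Finset.range k, z i) = 0 := by rw [h, sub_self, mul_zero]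
  simp only [mul_sub, Finset.sum_sub_distrib, mul_add, ← Finset.mul_sum] at e1 e2 e3
  linarith

/-- With entries capped at 1, a total of `k` is cheapest on the first `k` indices, where the weights
are least. -/
theorem sum_range_le_sum_mul {m k : ℕ} (hkm : k ≤ m) {w : ℕ → ℝ} {x : Fin m → ℝ}
    (hw : Monotone w) (h0 : ∀ i, 0 ≤ x i) (h1 : ∀ i, x i ≤ 1) (h : ∑ i, x i = k) :
    ∑ i ∈ Finset.range k, w i ≤ ∑ i : Fin m, w i * x i := by
  let y : ℕ → ℝ := fun i => if h : i < m then x ⟨i, h⟩ else 0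
  have hy : ∀ i : Fin m, y i = x i := fun i => by simp [y]
  have := sum_mul_le_sum_mul_of_crossing hkm hw (y := y) (z := fun _ => 1)
    (fun i hi => (hy ⟨i, by omega⟩).trans_le (h1 _))
    (fun i _ hi => (h0 _).trans_eq (hy ⟨i, hi⟩).symm)
    (by simpa [Finset.sum_range (n := m), hy] using h)
  simpa [Finset.sum_range (n := m), hy] using this

/-! ### The spread sequence -/

/-- The sequence that keeps `β_1, …, β_ι` and replaces every later entry by
`(1 / (k - ι)) ∑_{i > ι} β_i`. -/
noncomputable def spread (m k : ℕ) (β : ℕ → ℝ) (i : ℕ) : ℝ :=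
  if i < iota m k β then β i
  else (∑ j ∈ Finset.Ico (iota m k β) m, β j) / ((k : ℝ) - iota m k β)

/-- `∑_{i ≤ k} 1 / (μ_i + λ)`, with `μ` the sequence `spread m k β`. -/
noncomputable def spreadSum (m k : ℕ) (lam : ℝ) (β : ℕ → ℝ) : ℝ :=
  ∑ i ∈ Finset.range k, 1 / (spread m k β i + lam)

/-- The first `m` terms of `β` are nonincreasing, and all terms are nonnegative. -/
structure IsSpectrum (m : ℕ) (β : ℕ → ℝ) : Prop where
  anti : ∀ i j, i ≤ j → j < m → β j ≤ β i
  nonneg : ∀ i, 0 ≤ β i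

theorem isSpectrum_eig {m : ℕ} {Y : Matrix (Fin m) (Fin m) ℝ} (hY : Y.PosSemidef) :
    IsSpectrum m (eig Y) :=
  ⟨fun _ _ hij hj => eig_antitone Y hij hj, eig_nonneg hY⟩

theorem isIota_iota {m k : ℕ} {β : ℕ → ℝ} (hk : 1 ≤ k) (hkm : k ≤ m)
    (hβ : IsSpectrum m β) :
    IsIota m k β (iota m k β) :=
  Nat.sInf_mem (existsUnique_isIota hk hkm β hβ.anti hβ.nonneg).exists

theorem iota_lt {m k : ℕ} {β : ℕ → ℝ} (hk : 1 ≤ k) (hkm : k ≤ m)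
    (hβ : IsSpectrum m β) :
    iota m k β < k := (isIota_iota hk hkm hβ).1

theorem sub_iota_pos {m k : ℕ} {β : ℕ → ℝ} (hk : 1 ≤ k) (hkm : k ≤ m)
    (hβ : IsSpectrum m β) :
    (0 : ℝ) < (k : ℝ) - iota m k β :=
  sub_pos.2 (by exact_mod_cast iota_lt hk hkm hβ)

theorem le_spread {m k : ℕ} {β : ℕ → ℝ} (hk : 1 ≤ k) (hkm : k ≤ m)
    (hβ : IsSpectrum m β)
    {i : ℕ} (hi : i < m) : β i ≤ spread m k β i := by
  unfold spread
  split_ifs with h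
  · exact le_rfl
  · have := (isIota_iota hk hkm hβ).2.2
    rw [one_div_mul_eq_div] at this
    exact (hβ.anti _ _ (not_lt.1 h) hi).trans this

theorem spread_nonneg {m k : ℕ} {β : ℕ → ℝ} (hk : 1 ≤ k) (hkm : k ≤ m)
    (hβ : IsSpectrum m β)
    (i : ℕ) : 0 ≤ spread m k β i := by
  unfold spread
  split_ifs
  · exact hβ.nonneg i
  · exact div_nonneg (Finset.sum_nonneg fun j _ => hβ.nonneg j) (sub_iota_pos hk hkm hβ).le

theorem spread_eq_of_le {m k : ℕ} {β : ℕ → ℝ} (hk : 1 ≤ k) (hkm : k ≤ m)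
    (hβ : IsSpectrum m β)
    {i : ℕ} (hi : k ≤ i) : spread m k β i = spread m k β k := by
  have hι := iota_lt hk hkm hβ
  rw [spread, spread, if_neg (by omega), if_neg (by omega)]

theorem spread_antitone {m k : ℕ} {β : ℕ → ℝ} (hk : 1 ≤ k) (hkm : k ≤ m)
    (hβ : IsSpectrum m β) :
    Antitone (spread m k β) := by
  intro i j hij
  have hι := iota_lt hk hkm hβ
  unfold spread
  split_ifs with h1 h2
  · exact hβ.anti _ _ hij (by omega)
  · omega
  · have := (isIota_iota hk hkm hβ).2.1.resolve_left (by omega)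
    rw [one_div_mul_eq_div] at this
    exact this.le.trans (hβ.anti _ _ (by omega) (by omega))
  · exact le_rfl

/-- Before ι the sequences agree. From ι on the coefficient is constant, and k - ι copies of the
tail value have the same total as the tail of β. -/
theorem sum_mul_spread_eq {m k : ℕ} {β : ℕ → ℝ} (hk : 1 ≤ k) (hkm : k ≤ m)
    (hβ : IsSpectrum m β)
    (f : ℝ → ℝ) :
    ∑ i ∈ Finset.range k, f (spread m k β i) * spread m k β i =
      ∑ i ∈ Finset.range m, f (spread m k β i) * β i := by
  have hι := iota_lt hk hkm hβ
  rw [← Finset.sum_range_add_sum_Ico _ hι.le, ← Finset.sum_range_add_sum_Ico _ (hι.le.trans hkm)]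
  congr 1
  · refine Finset.sum_congr rfl fun i hi => ?_
    simp [spread, Finset.mem_range.1 hi]
  · set t := (∑ j ∈ Finset.Ico (iota m k β) m, β j) / ((k : ℝ) - iota m k β) with ht
    have hs : ∀ i, iota m k β ≤ i → spread m k β i = t := fun i hi => by
      simp [spread, not_lt.2 hi, ht]
    have e1 : ∑ i ∈ Finset.Ico (iota m k β) k, f (spread m k β i) * spread m k β i =
        ∑ i ∈ Finset.Ico (iota m k β) k, f t * t :=
      Finset.sum_congr rfl fun i hi => by rw [hs i (Finset.mem_Ico.1 hi).1]
    have e2 : ∑ i ∈ Finset.Ico (iota m k β) m, f (spread m k β i) * β i =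
        ∑ i ∈ Finset.Ico (iota m k β) m, f t * β i :=
      Finset.sum_congr rfl fun i hi => by rw [hs i (Finset.mem_Ico.1 hi).1]
    have ht' : ((k : ℝ) - iota m k β) * t = ∑ j ∈ Finset.Ico (iota m k β) m, β j :=
      mul_div_cancel₀ _ (sub_iota_pos hk hkm hβ).ne'
    rw [e1, e2, Finset.sum_const, ← Finset.mul_sum, Nat.card_Ico, nsmul_eq_mul,
      Nat.cast_sub hι.le, ← ht']
    ring

theorem sum_spread_eq {m k : ℕ} {β : ℕ → ℝ} (hk : 1 ≤ k) (hkm : k ≤ m)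
    (hβ : IsSpectrum m β) :
    ∑ i ∈ Finset.range k, spread m k β i = ∑ i ∈ Finset.range m, β i := by
  simpa using sum_mul_spread_eq hk hkm hβ (fun _ => 1)

theorem sum_mul_spread_le {m k : ℕ} {β : ℕ → ℝ} (hk : 1 ≤ k) (hkm : k ≤ m)
    (hβ : IsSpectrum m β)
    {w : ℕ → ℝ} (hw : Monotone w) :
    ∑ i ∈ Finset.range k, w i * spread m k β i ≤ ∑ i ∈ Finset.range m, w i * β i :=
  sum_mul_le_sum_mul_of_crossing hkm hw
    (fun _ hi => le_spread hk hkm hβ (by omega)) (fun i _ _ => hβ.nonneg i)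
    (sum_spread_eq hk hkm hβ).symm

theorem phi_eq_spreadSum {m k : ℕ} {β : ℕ → ℝ} (hk : 1 ≤ k) (hkm : k ≤ m)
    (hβ : IsSpectrum m β) :
    phi m k β = spreadSum m k 0 β := by
  have hι := iota_lt hk hkm hβ
  rw [phi, spreadSum, ← Finset.sum_range_add_sum_Ico _ hι.le]
  congr 1
  · refine Finset.sum_congr rfl fun i hi => ?_
    simp [spread, Finset.mem_range.1 hi]
  · have e1 : ∑ i ∈ Finset.Ico (iota m k β) k, 1 / (spread m k β i + 0) =
        ∑ i ∈ Finset.Ico (iota m k β) k,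
          ((k : ℝ) - iota m k β) / ∑ j ∈ Finset.Ico (iota m k β) m, β j :=
      Finset.sum_congr rfl fun i hi => by
        simp [spread, not_lt.2 (Finset.mem_Ico.1 hi).1]
    rw [e1, Finset.sum_const, Nat.card_Ico, nsmul_eq_mul, Nat.cast_sub hι.le]
    ring

/-- The smallest entry is the tail value, whose numerator contains the sum from index `k - 1` on
because ι ≤ k - 1. -/
theorem spread_pos {m k : ℕ} {β : ℕ → ℝ} (hk : 1 ≤ k) (hkm : k ≤ m)
    (hβ : IsSpectrum m β)
    (h : 0 < ∑ i ∈ Finset.Ico (k - 1) m, β i) (i : ℕ) : 0 < spread m k β i := by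
  have hι := iota_lt hk hkm hβ
  refine lt_of_lt_of_le ?_ (spread_antitone hk hkm hβ (le_max_left i (iota m k β)))
  rw [spread, if_neg (by omega)]
  refine div_pos (h.trans_le ?_) (sub_iota_pos hk hkm hβ)
  exact Finset.sum_le_sum_of_subset_of_nonneg (Finset.Ico_subset_Ico_left (by omega))
    fun j _ _ => hβ.nonneg j

/-! ### Supporting functionals and convexity -/

/-- The tangent line of `t ↦ 1 / t` lies below the graph. -/
theorem tangent_le_one_div {s t : ℝ} (hs : 0 < s) (ht : 0 < t) :
    2 / s - 1 / s ^ 2 * t ≤ 1 / t := by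
  have : 1 / t - (2 / s - 1 / s ^ 2 * t) = (s - t) ^ 2 / (t * s ^ 2) := by
    field_simp
    ring
  have h2 : 0 ≤ (s - t) ^ 2 / (t * s ^ 2) := by positivity
  linarith

/-- The slopes of the supporting functional of `spreadSum` at `β`. -/
noncomputable def slope (m k : ℕ) (lam : ℝ) (β : ℕ → ℝ) (i : ℕ) : ℝ :=
  1 / (spread m k β i + lam) ^ 2

theorem slope_monotone {m k : ℕ} {β : ℕ → ℝ} (hk : 1 ≤ k) (hkm : k ≤ m) (hβ : IsSpectrum m β)
    {lam : ℝ} (hpos : ∀ i, 0 < spread m k β i + lam) : Monotone (slope m k lam β) := by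
  intro i j hij
  unfold slope
  have h1 := spread_antitone hk hkm hβ hij
  have h2 := hpos j
  gcongr

/-- The constant of the supporting functional of `spreadSum` at `β`. -/
noncomputable def intercept (m k : ℕ) (lam : ℝ) (β : ℕ → ℝ) : ℝ :=
  ∑ i ∈ Finset.range k, (2 / (spread m k β i + lam) - slope m k lam β i * lam)

theorem spreadSum_eq {m k : ℕ} {β : ℕ → ℝ} (hk : 1 ≤ k) (hkm : k ≤ m) (hβ : IsSpectrum m β)
    {lam : ℝ} (hpos : ∀ i, 0 < spread m k β i + lam) :
    spreadSum m k lam β =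
      intercept m k lam β - ∑ i ∈ Finset.range m, slope m k lam β i * β i := by
  have := sum_mul_spread_eq hk hkm hβ (fun s => 1 / (s + lam) ^ 2)
  rw [show ∑ i ∈ Finset.range m, slope m k lam β i * β i = _ from this.symm, spreadSum, intercept,
    ← Finset.sum_sub_distrib]
  refine Finset.sum_congr rfl fun i _ => ?_
  have := (hpos i).ne'
  rw [slope]
  field_simp
  ring

/-- The slopes increase, so γ may be replaced by its spread; termwise it is then the tangent of 1/t
at the shifted spread of β. By `spreadSum_eq`, equality holds at γ = β. -/
theorem le_spreadSum {m k : ℕ} {β γ : ℕ → ℝ} (hk : 1 ≤ k) (hkm : k ≤ m) (hβ : IsSpectrum m β)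
    (hγ : IsSpectrum m γ) {lam : ℝ} (hpos : ∀ i, 0 < spread m k β i + lam)
    (hpos' : ∀ i, 0 < spread m k γ i + lam) :
    intercept m k lam β - ∑ i ∈ Finset.range m, slope m k lam β i * γ i ≤
      spreadSum m k lam γ := by
  have h1 := sum_mul_spread_le hk hkm hγ (slope_monotone hk hkm hβ hpos)
  refine (sub_le_sub_left h1 _).trans ?_
  rw [intercept, spreadSum, ← Finset.sum_sub_distrib]
  refine Finset.sum_le_sum fun i _ => ?_
  have := tangent_le_one_div (hpos i) (hpos' i)
  rw [slope]
  linarith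

/-- A function that has an affine minorant touching it at every point of a convex set is convex
there. -/
theorem convexOn_of_forall_exists_affine {E : Type*} [AddCommGroup E] [Module ℝ E] {s : Set E}
    (hs : Convex ℝ s) {f : E → ℝ}
    (h : ∀ z ∈ s, ∃ (L : E →ₗ[ℝ] ℝ) (c : ℝ), f z = c + L z ∧ ∀ y ∈ s, c + L y ≤ f y) :
    ConvexOn ℝ s f := by
  refine ⟨hs, fun x hx y hy a b ha hb hab => ?_⟩
  obtain ⟨L, c, h1, h2⟩ := h _ (hs hx hy ha hb hab)
  have e1 := mul_le_mul_of_nonneg_left (h2 x hx) ha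
  have e2 := mul_le_mul_of_nonneg_left (h2 y hy) hb
  have e3 : c = a * c + b * c := by rw [← add_mul, hab, one_mul]
  simp only [map_add, map_smul, smul_eq_mul] at h1 ⊢
  linarith

theorem convex_psdCone (m : ℕ) : Convex ℝ (psdCone m) := by
  intro X hX Y hY a b ha hb _
  exact (Matrix.PosSemidef.smul hX ha).add (Matrix.PosSemidef.smul hY hb)

/-- `Y ↦ -∑_i w_i (Qᵀ Y Q)_{ii}`. -/
def negWeightedDiag {m : ℕ} (w : ℕ → ℝ) (Q : Matrix (Fin m) (Fin m) ℝ) :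
    Matrix (Fin m) (Fin m) ℝ →ₗ[ℝ] ℝ where
  toFun Y := -∑ i : Fin m, w i * (Q.transpose * Y * Q) i i
  map_add' X Y := by
    simp only [Matrix.add_mul, Matrix.add_apply, mul_add, Finset.sum_add_distrib,
      neg_add]
  map_smul' r Y := by
    simp only [Matrix.mul_smul, Matrix.smul_mul, Matrix.smul_apply, smul_eq_mul, RingHom.id_apply,
      Finset.mul_sum, mul_neg]
    congr 1
    exact Finset.sum_congr rfl fun i _ => by ring

/-- `spreadSum ∘ eig` has an affine minorant touching it at each positive semidefinite matrix. -/
theorem exists_affine_le_spreadSum {m k : ℕ} (hk : 1 ≤ k) (hkm : k ≤ m) {lam : ℝ}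
    {Z : Matrix (Fin m) (Fin m) ℝ} (hZ : Z.PosSemidef)
    (hpos : ∀ i, 0 < spread m k (eig Z) i + lam) :
    ∃ (L : Matrix (Fin m) (Fin m) ℝ →ₗ[ℝ] ℝ) (c : ℝ),
      spreadSum m k lam (eig Z) = c + L Z ∧
      ∀ Y : Matrix (Fin m) (Fin m) ℝ, Y.PosSemidef → (∀ i, 0 < spread m k (eig Y) i + lam) →
        c + L Y ≤ spreadSum m k lam (eig Y) := by
  obtain ⟨Q, hQ, h⟩ := exists_orthogonal_diagonalization hZ.1
  have hZs := isSpectrum_eig hZ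
  refine ⟨negWeightedDiag (slope m k lam (eig Z)) Q, intercept m k lam (eig Z), ?_, ?_⟩
  · rw [spreadSum_eq hk hkm hZs hpos, sub_eq_add_neg, Finset.sum_range]
    simp only [negWeightedDiag, LinearMap.coe_mk, AddHom.coe_mk, eig_eq_diag_conj hQ h]
  · intro Y hY hposY
    refine le_trans ?_ (le_spreadSum hk hkm hZs (isSpectrum_eig hY) hpos hposY)
    -- `Q` diagonalizes `Z`, not `Y`: the diagonal is linear in `Y`, and it bounds the weighted
    -- ordered eigenvalues from above.
    have := sum_mul_eig_le hY.1 hQ (slope_monotone hk hkm hZs hpos)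
    rw [sub_eq_add_neg, Finset.sum_range]
    simp only [negWeightedDiag, LinearMap.coe_mk, AddHom.coe_mk]
    linarith

theorem spread_add_pos {m k : ℕ} (hk : 1 ≤ k) (hkm : k ≤ m) {lam : ℝ} (hlam : 0 < lam)
    {Z : Matrix (Fin m) (Fin m) ℝ} (hZ : Z.PosSemidef) (i : ℕ) :
    0 < spread m k (eig Z) i + lam :=
  add_pos_of_nonneg_of_pos (spread_nonneg hk hkm (isSpectrum_eig hZ) i) hlam

theorem convexOn_spreadSum {m k : ℕ} (hk : 1 ≤ k) (hkm : k ≤ m) {lam : ℝ} (hlam : 0 < lam) :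
    ConvexOn ℝ (psdCone m) (fun X => spreadSum m k lam (eig X)) := by
  refine convexOn_of_forall_exists_affine (convex_psdCone m) fun Z hZ => ?_
  obtain ⟨L, c, h1, h2⟩ := exists_affine_le_spreadSum hk hkm hZ (spread_add_pos hk hkm hlam hZ)
  exact ⟨L, c, h1, fun Y hY => h2 Y hY (spread_add_pos hk hkm hlam hY)⟩

/-! ### The convex envelope of Γ -/

theorem spreadSum_le_Gam {d k : ℕ} (hd : 1 ≤ d) (hk : 1 ≤ k) {lam : ℝ} (hlam : 0 < lam)
    {X : Matrix (Fin d) (Fin d) ℝ} (hX : X.PosSemidef) :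
    spreadSum d (min k d) lam (eig X) ≤ Gam k lam X := by
  refine Finset.sum_le_sum fun i hi => ?_
  have hi' := Finset.mem_range.1 hi
  have h1 := le_spread (le_min hk hd) (min_le_right k d) (isSpectrum_eig hX)
    (show i < d by omega)
  have h2 := eig_nonneg hX i
  exact one_div_le_one_div_of_le (by linarith) (by linarith)

theorem sum_indicator_lt {m r : ℕ} (hrm : r ≤ m) :
    ∑ i : Fin m, (if (i : ℕ) < r then (1 : ℝ) else 0) = r := by
  rw [Fin.sum_univ_eq_sum_range (fun i => if i < r then (1 : ℝ) else 0) m,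
    ← Finset.sum_range_add_sum_Ico _ hrm,
    Finset.sum_congr rfl (fun i hi => if_pos (Finset.mem_range.1 hi)),
    Finset.sum_congr rfl (fun i hi => if_neg (not_lt.2 (Finset.mem_Ico.1 hi).1))]
  simp

/-- Every point of the hypersimplex is a convex combination of images of its first vertex under
permutations of the coordinates. -/
theorem exists_eq_sum_perm_of_mem_hypersimplex {m r : ℕ} (hrm : r ≤ m) {p : Fin m → ℝ}
    (h0 : ∀ i, 0 ≤ p i) (h1 : ∀ i, p i ≤ 1) (hs : ∑ i, p i = r) :
    ∃ c : Equiv.Perm (Fin m) → ℝ, (∀ σ, 0 ≤ c σ) ∧ ∑ σ, c σ = 1 ∧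
      ∀ j, p j = ∑ σ, c σ * if (σ j : ℕ) < r then 1 else 0 := by
  have hcard := sum_indicator_lt hrm
  have hcard' : ∑ i : Fin m, (if (i : ℕ) < r then (0 : ℝ) else 1) = m - r := by
    have : ∀ i : Fin m, (if (i : ℕ) < r then (0 : ℝ) else 1) =
        1 - if (i : ℕ) < r then (1 : ℝ) else 0 := fun i => by split_ifs <;> simp
    simp only [this, Finset.sum_sub_distrib, hcard]
    simp
  have hs' : ∑ i, (1 - p i) = (m : ℝ) - r := by simp [Finset.sum_sub_distrib, hs]
  have hmr : (0 : ℝ) ≤ (m : ℝ) - r := sub_nonneg.2 (by exact_mod_cast hrm)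
  -- Row `j` spreads the mass `p j` evenly over the first `r` columns and `1 - p j` over the rest,
  -- so `M` sends the first vertex to `p`. If `r` is 0 or `m`, one numerator vanishes along with its
  -- denominator.
  let M : Matrix (Fin m) (Fin m) ℝ := Matrix.of fun j i =>
    (if (i : ℕ) < r then 1 else 0) * (p j / r) + (if (i : ℕ) < r then 0 else 1) *
      ((1 - p j) / (m - r))
  have e1 : ∀ j, (r : ℝ) * (p j / r) = p j := by
    intro j
    rcases eq_or_ne (r : ℝ) 0 with hr | hr
    · have : p j = 0 :=
        (Finset.sum_eq_zero_iff_of_nonneg fun i _ => h0 i).1 (hs.trans hr) j (Finset.mem_univ j)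
      simp [this]
    · field_simp
  have e2 : ∀ j, ((m : ℝ) - r) * ((1 - p j) / (m - r)) = 1 - p j := by
    intro j
    rcases eq_or_ne ((m : ℝ) - r) 0 with hr | hr
    · have : 1 - p j = 0 :=
        (Finset.sum_eq_zero_iff_of_nonneg fun i _ => sub_nonneg.2 (h1 i)).1 (hs'.trans hr) j
          (Finset.mem_univ j)
      simp [this]
    · field_simp
  have hM : M ∈ doublyStochastic ℝ (Fin m) := by
    rw [mem_doublyStochastic_iff_sum]
    refine ⟨fun j i => ?_, fun j => ?_, fun i => ?_⟩
    · have a1 := div_nonneg (h0 j) (Nat.cast_nonneg r)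
      have a2 := div_nonneg (sub_nonneg.2 (h1 j)) hmr
      simp only [M, Matrix.of_apply]
      split_ifs <;> simp [a1, a2]
    · simp only [M, Matrix.of_apply, Finset.sum_add_distrib, ← Finset.sum_mul, hcard, hcard',
        e1, e2]
      ring
    · simp only [M, Matrix.of_apply, Finset.sum_add_distrib, ← Finset.mul_sum, ← Finset.sum_div,
        hs, hs']
      split_ifs with hi
      · have : (r : ℝ) ≠ 0 := by exact_mod_cast (by omega : r ≠ 0)
        simp [this]
      · have : (m : ℝ) - r ≠ 0 := sub_ne_zero.2 (by exact_mod_cast (by omega : m ≠ r))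
        simp [this]
  obtain ⟨c, hc0, hc1, hcM⟩ := exists_eq_sum_perm_of_mem_doublyStochastic hM
  refine ⟨c, hc0, hc1, fun j => ?_⟩
  have e3 : p j = ∑ i : Fin m, M j i * if (i : ℕ) < r then 1 else 0 := by
    have : ∀ i : Fin m, (M j i * if (i : ℕ) < r then (1 : ℝ) else 0) =
        (if (i : ℕ) < r then 1 else 0) * (p j / r) := by
      intro i
      simp only [M, Matrix.of_apply]
      split_ifs <;> simp
    rw [Finset.sum_congr rfl fun i _ => this i, ← Finset.sum_mul, hcard, e1]
  rw [e3, ← hcM]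
  simp only [Matrix.sum_apply, Matrix.smul_apply, smul_eq_mul, Finset.sum_mul]
  rw [Finset.sum_comm]
  refine Finset.sum_congr rfl fun σ _ => ?_
  rw [Finset.sum_eq_single (σ j)]
  · simp [Equiv.Perm.permMatrix, PEquiv.toMatrix_apply, Equiv.toPEquiv_apply]
  · intro i _ hi
    simp [Equiv.Perm.permMatrix, PEquiv.toMatrix_apply, Equiv.toPEquiv_apply, hi.symm]
  · simp

/-- `Γ` is at most the sum over any `min k d` of the eigenvalues. -/
theorem Gam_conj_diagonal_le {d k : ℕ} {lam : ℝ} (hlam : 0 < lam) {Q : Matrix (Fin d) (Fin d) ℝ}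
    (hQ : Q.transpose * Q = 1) {v : Fin d → ℝ} (hv : ∀ i, 0 ≤ v i) (σ : Equiv.Perm (Fin d)) :
    Gam k lam (Q * Matrix.diagonal v * Q.transpose) ≤
      ∑ i, (if (σ i : ℕ) < min k d then 1 else 0) * (1 / (v i + lam)) := by
  set Y := Q * Matrix.diagonal v * Q.transpose with hYdef
  have hY : Y.PosSemidef := by
    have := (Matrix.PosSemidef.diagonal (R := ℝ) (d := v) hv).mul_mul_conjTranspose_same Q
    simpa using this
  obtain ⟨τ, hτ⟩ := exists_perm_eig_eq hY.1 (charpoly_conj_diagonal hQ v)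
  -- Monotone on all of ℕ because `eig` defaults to 0 past `d`, giving the largest possible value
  -- 1/λ.
  have hw : Monotone fun i : ℕ => 1 / (eig Y i + lam) := by
    intro i j hij
    have h1 := eig_nonneg hY j
    refine one_div_le_one_div_of_le (by linarith) ?_
    rcases lt_or_ge j d with hj | hj
    · linarith [eig_antitone Y hij hj]
    · rw [eig_of_le Y hj]
      linarith [eig_nonneg hY i]
  have key := sum_range_le_sum_mul
    (x := fun i : Fin d => if (σ (τ i) : ℕ) < min k d then (1 : ℝ) else 0) (min_le_right k d) hw
    (fun i => by split_ifs <;> norm_num) (fun i => by split_ifs <;> norm_num) (by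
      rw [Equiv.sum_comp τ fun i => if (σ i : ℕ) < min k d then (1 : ℝ) else 0,
        Equiv.sum_comp σ fun i => if (i : ℕ) < min k d then (1 : ℝ) else 0]
      exact sum_indicator_lt (min_le_right k d))
  refine key.trans_eq ?_
  rw [← Equiv.sum_comp τ fun i =>
    (if (σ i : ℕ) < min k d then (1 : ℝ) else 0) * (1 / (v i + lam))]
  refine Finset.sum_congr rfl fun i _ => ?_
  rw [hτ, mul_comm]

/-- A convex minorant of `Γ` at a matrix whose spectrum is `μ p`, with `p` in the hypersimplex. -/
theorem le_sum_of_convexOn_of_le_Gam {d k : ℕ} {lam : ℝ} (hlam : 0 < lam)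
    {g : Matrix (Fin d) (Fin d) ℝ → ℝ} (hg : ConvexOn ℝ (psdCone d) g)
    (hgG : ∀ Y ∈ psdCone d, g Y ≤ Gam k lam Y) {Q : Matrix (Fin d) (Fin d) ℝ}
    (hQ : Q.transpose * Q = 1) {μ p : Fin d → ℝ} (hμ : ∀ i, 0 ≤ μ i) (h0 : ∀ i, 0 ≤ p i)
    (h1 : ∀ i, p i ≤ 1) (hs : ∑ i, p i = (min k d : ℕ)) :
    g (Q * Matrix.diagonal (fun i => μ i * p i) * Q.transpose) ≤
      ∑ i, p i * (1 / (μ i + lam)) := by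
  obtain ⟨c, hc0, hc1, hp⟩ := exists_eq_sum_perm_of_mem_hypersimplex (min_le_right k d) h0 h1 hs
  let v : Equiv.Perm (Fin d) → Fin d → ℝ := fun σ i =>
    μ i * if (σ i : ℕ) < min k d then 1 else 0
  have hv : ∀ σ i, 0 ≤ v σ i := fun σ i => by
    simp only [v]
    split_ifs <;> simp [hμ]
  let M : Equiv.Perm (Fin d) → Matrix (Fin d) (Fin d) ℝ := fun σ =>
    Q * Matrix.diagonal (v σ) * Q.transpose
  have hM : ∀ σ, M σ ∈ psdCone d := fun σ => by
    have := (Matrix.PosSemidef.diagonal (R := ℝ) (d := v σ) (hv σ)).mul_mul_conjTranspose_same Q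
    simpa [psdCone] using this
  have hsum : Q * Matrix.diagonal (fun i => μ i * p i) * Q.transpose = ∑ σ, c σ • M σ := by
    have : Matrix.diagonal (fun i => μ i * p i) = ∑ σ, c σ • Matrix.diagonal (v σ) := by
      ext i j
      rw [Matrix.sum_apply]
      rcases eq_or_ne i j with rfl | hij
      · simp only [Matrix.smul_apply, Matrix.diagonal_apply_eq, v, smul_eq_mul]
        rw [hp i, Finset.mul_sum]
        exact Finset.sum_congr rfl fun σ _ => by ring
      · simp [Matrix.diagonal_apply_ne _ hij]
    simp only [M, this, Matrix.mul_sum, Matrix.sum_mul, Matrix.mul_smul, Matrix.smul_mul]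
  rw [hsum]
  refine (hg.map_sum_le (fun σ _ => hc0 σ) hc1 fun σ _ => hM σ).trans ?_
  -- On the selected indices `v σ` equals μ; elsewhere the coefficient is 0.
  have hle : ∀ σ, g (M σ) ≤
      ∑ i, (if (σ i : ℕ) < min k d then 1 else 0) * (1 / (μ i + lam)) := by
    intro σ
    refine (hgG _ (hM σ)).trans ((Gam_conj_diagonal_le hlam hQ (hv σ) σ).trans_eq ?_)
    refine Finset.sum_congr rfl fun i _ => ?_
    simp only [v]
    split_ifs <;> simp
  refine (Finset.sum_le_sum fun σ _ => mul_le_mul_of_nonneg_left (hle σ) (hc0 σ)).trans_eq ?_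
  simp only [Finset.mul_sum]
  rw [Finset.sum_comm]
  refine Finset.sum_congr rfl fun i _ => ?_
  rw [hp i, Finset.sum_mul]
  exact Finset.sum_congr rfl fun σ _ => by ring

theorem le_spreadSum_of_convexOn_of_le_Gam {d k : ℕ} (hd : 1 ≤ d) (hk : 1 ≤ k) {lam : ℝ}
    (hlam : 0 < lam) {g : Matrix (Fin d) (Fin d) ℝ → ℝ} (hg : ConvexOn ℝ (psdCone d) g)
    (hgG : ∀ Y ∈ psdCone d, g Y ≤ Gam k lam Y) {X : Matrix (Fin d) (Fin d) ℝ}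
    (hX : X.PosSemidef) : g X ≤ spreadSum d (min k d) lam (eig X) := by
  obtain ⟨Q, hQ, h⟩ := exists_orthogonal_diagonalization hX.1
  have hβ := isSpectrum_eig hX
  have hr1 : 1 ≤ min k d := le_min hk hd
  have hrd := min_le_right k d
  set r := min k d with hr
  set μ := spread d r (eig X) with hμdef
  have hμ0 : ∀ i, 0 ≤ μ i := spread_nonneg hr1 hrd hβ
  have hμa : Antitone μ := spread_antitone hr1 hrd hβ
  have hle : ∀ i : Fin d, eig X i ≤ μ i := fun i => le_spread hr1 hrd hβ i.2
  suffices H : ∃ p : Fin d → ℝ, (∀ i, 0 ≤ p i) ∧ (∀ i, p i ≤ 1) ∧ ∑ i, p i = (r : ℕ) ∧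
      (∀ i : Fin d, eig X i = μ i * p i) ∧
      ∑ i, p i * (1 / (μ i + lam)) = spreadSum d r lam (eig X) by
    obtain ⟨p, h0, h1, hs, hp, hF⟩ := H
    rw [← hF, h]
    simp only [hp]
    exact le_sum_of_convexOn_of_le_Gam hlam hg hgG hQ (fun i => hμ0 i) h0 h1 hs
  -- `μ r` is the constant tail value. If it is positive, take p = β/μ. If it is 0, that ratio may
  -- be 0/0, but β vanishes from `r` on and equals μ before, so the first vertex serves.
  rcases (hμ0 r).eq_or_lt with ht | ht
  · have htail : ∀ i, r ≤ i → μ i = 0 := fun i hi =>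
      le_antisymm ((hμa hi).trans ht.ge) (hμ0 i)
    have hz : ∀ i ∈ Finset.Ico r d, eig X i = 0 := fun i hi => by
      obtain ⟨hi1, hi2⟩ := Finset.mem_Ico.1 hi
      exact le_antisymm ((hle ⟨i, hi2⟩).trans (htail i hi1).le) (hβ.nonneg i)
    have hsum := sum_spread_eq hr1 hrd hβ
    rw [← Finset.sum_range_add_sum_Ico _ hrd, Finset.sum_eq_zero hz, add_zero] at hsum
    have heq : ∀ i ∈ Finset.range r, eig X i = μ i :=
      (Finset.sum_eq_sum_iff_of_le fun i hi =>
        hle ⟨i, (Finset.mem_range.1 hi).trans_le hrd⟩).1 hsum.symm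
    refine ⟨fun i => if (i : ℕ) < r then 1 else 0, fun i => by dsimp only; split_ifs <;> simp,
      fun i => by dsimp only; split_ifs <;> simp, sum_indicator_lt hrd, fun i => ?_, ?_⟩
    · dsimp only
      split_ifs with hi
      · rw [mul_one, heq i (Finset.mem_range.2 hi)]
      · rw [mul_zero, hz i (Finset.mem_Ico.2 ⟨not_lt.1 hi, i.2⟩)]
    · rw [spreadSum, Fin.sum_univ_eq_sum_range
        (fun i => (if i < r then (1 : ℝ) else 0) * (1 / (μ i + lam))) d,
        ← Finset.sum_range_add_sum_Ico _ hrd,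
        Finset.sum_eq_zero (s := Finset.Ico r d) fun i hi => by
          simp [not_lt.2 (Finset.mem_Ico.1 hi).1], add_zero]
      exact Finset.sum_congr rfl fun i hi => by simp [Finset.mem_range.1 hi, hμdef]
  · have hpos : ∀ i, 0 < μ i := fun i => by
      rcases le_total i r with hi | hi
      · exact ht.trans_le (hμa hi)
      · rwa [hμdef, spread_eq_of_le hr1 hrd hβ hi]
    refine ⟨fun i => eig X i / μ i, fun i => div_nonneg (hβ.nonneg i) (hμ0 i),
      fun i => (div_le_one (hpos i)).2 (hle i), ?_, fun i => ?_, ?_⟩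
    · have := sum_mul_spread_eq hr1 hrd hβ fun s => 1 / s
      rw [Finset.sum_congr rfl fun i _ => one_div_mul_cancel (hpos i).ne', Finset.sum_range
        (n := d)] at this
      simp only [Finset.sum_const, Finset.card_range, nsmul_eq_mul, mul_one] at this
      rw [this]
      exact Finset.sum_congr rfl fun i _ => by rw [one_div_mul_eq_div]
    · have := (hpos i).ne'
      field_simp
    -- This coefficient turns μ_i into 1/(μ_i + λ) and β_i into p_i/(μ_i + λ).
    · have := sum_mul_spread_eq hr1 hrd hβ fun s => 1 / (s * (s + lam))
      rw [Finset.sum_range (n := d)] at this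
      rw [spreadSum]
      have e1 : ∀ i : Fin d, eig X i / μ i * (1 / (μ i + lam)) =
          1 / (μ i * (μ i + lam)) * eig X i := fun i => by
        have h1 := (hpos i).ne'
        have h2 : μ i + lam ≠ 0 := (add_pos (hpos i) hlam).ne'
        field_simp
      rw [Finset.sum_congr rfl fun i _ => e1 i]
      refine this.symm.trans (Finset.sum_congr rfl fun i _ => ?_)
      have h1 := (hpos i).ne'
      have h2 : μ i + lam ≠ 0 := (add_pos (hpos i) hlam).ne'
      change 1 / (μ i * (μ i + lam)) * μ i = 1 / (μ i + lam)
      field_simp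

theorem convGam_eq_spreadSum {d k : ℕ} (hd : 1 ≤ d) (hk : 1 ≤ k) {lam : ℝ} (hlam : 0 < lam)
    {X : Matrix (Fin d) (Fin d) ℝ} (hX : X.PosSemidef) :
    convGam k lam X = spreadSum d (min k d) lam (eig X) := by
  refine IsGreatest.csSup_eq ⟨⟨fun Y => spreadSum d (min k d) lam (eig Y),
    convexOn_spreadSum (le_min hk hd) (min_le_right k d) hlam,
    fun Y hY => spreadSum_le_Gam hd hk hlam hY, rfl⟩, ?_⟩
  rintro _ ⟨g, hg, hgG, rfl⟩
  exact le_spreadSum_of_convexOn_of_le_Gam hd hk hlam hg hgG hX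

/-! ### Attainment on the feasible set -/

theorem isCompact_feasible (n k : ℕ) : IsCompact (feasible n k) := by
  have h : feasible n k = Set.Icc (0 : Fin n → ℝ) 1 ∩ {x | ∑ i, x i = (k : ℝ)} := by
    ext x
    simp only [feasible, Set.mem_ofPred_eq, Set.mem_inter_iff, Set.mem_Icc, Pi.le_def,
      forall_and, Pi.zero_apply, Pi.one_apply]
  rw [h]
  exact isCompact_Icc.inter_right
    (isClosed_eq (continuous_finsetSum _ fun i _ => continuous_apply i) continuous_const)

theorem feasible_nonempty {n k : ℕ} (hk : 1 ≤ k) (hkn : k ≤ n) : (feasible n k).Nonempty := by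
  have hn : (0 : ℝ) < n := by exact_mod_cast (by omega : 0 < n)
  refine ⟨fun _ => k / n, fun i => ⟨by positivity, ?_⟩, ?_⟩
  · rw [div_le_one hn]
    exact_mod_cast hkn
  · simp only [Finset.sum_const, Finset.card_univ, Fintype.card_fin, nsmul_eq_mul]
    field_simp

theorem map_wsum {n m : ℕ} (L : Matrix (Fin m) (Fin m) ℝ →ₗ[ℝ] ℝ) (v : Fin n → Fin m → ℝ)
    (x : Fin n → ℝ) : L (wsum v x) = ∑ i, x i * L (Matrix.vecMulVec (v i) (v i)) := by
  simp [wsum]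

/-- A function of `∑_i x_i v_i v_iᵀ` that has affine minorants touching it at every feasible point
attains its minimum over the feasible set. -/
theorem isLeast_image_feasible {n k m : ℕ} (hk : 1 ≤ k) (hkn : k ≤ n) (v : Fin n → Fin m → ℝ)
    {f : (Fin n → ℝ) → ℝ}
    (h : ∀ z ∈ feasible n k, ∃ (L : Matrix (Fin m) (Fin m) ℝ →ₗ[ℝ] ℝ) (c : ℝ),
      f z = c + L (wsum v z) ∧ ∀ x ∈ feasible n k, c + L (wsum v x) ≤ f x) :
    IsLeast (f '' feasible n k) (sInf (f '' feasible n k)) := by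
  have hlsc : LowerSemicontinuousOn f (feasible n k) := by
    intro z hz y hy
    obtain ⟨L, c, h1, h2⟩ := h z hz
    have hc : Continuous fun x : Fin n → ℝ => c + L (wsum v x) := by
      simp only [map_wsum]
      fun_prop
    have := hc.continuousAt.eventually (lt_mem_nhds (h1 ▸ hy))
    filter_upwards [nhdsWithin_le_nhds this, self_mem_nhdsWithin] with x hx hxP
    exact hx.trans_le (h2 x hxP)
  obtain ⟨x, hx, hmin⟩ :=
    hlsc.exists_isMinOn (feasible_nonempty hk hkn) (isCompact_feasible n k)
  have : IsLeast (f '' feasible n k) (f x) := by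
    refine ⟨Set.mem_image_of_mem f hx, ?_⟩
    rintro _ ⟨y, hy, rfl⟩
    exact hmin hy
  rwa [this.csInf_eq]

/-! ### The objectives as spread sums -/

theorem wsum_eq {n m : ℕ} (v : Fin n → Fin m → ℝ) (x : Fin n → ℝ) :
    wsum v x = colMatrix v * Matrix.diagonal x * (colMatrix v).transpose := by
  ext i j
  rw [wsum, Matrix.sum_apply, Matrix.mul_apply]
  refine Finset.sum_congr rfl fun l _ => ?_
  simp only [Matrix.smul_apply, Matrix.vecMulVec_apply, smul_eq_mul, Matrix.mul_diagonal,
    Matrix.transpose_apply, colMatrix, Matrix.of_apply]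
  ring

theorem diagonal_sqrt_mul_self {n : ℕ} {x : Fin n → ℝ} (hx : ∀ i, 0 ≤ x i) :
    Matrix.diagonal (fun i => √(x i)) * Matrix.diagonal (fun i => √(x i)) =
      Matrix.diagonal x := by
  rw [Matrix.diagonal_mul_diagonal]
  congr 1
  funext i
  exact Real.mul_self_sqrt (hx i)

theorem mul_diagonal_sqrt_mul_transpose {n m : ℕ} {x : Fin n → ℝ} (hx : ∀ i, 0 ≤ x i)
    (V : Matrix (Fin m) (Fin n) ℝ) :
    (V * Matrix.diagonal fun i => √(x i)) * (V * Matrix.diagonal fun i => √(x i)).transpose =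
      V * Matrix.diagonal x * V.transpose := by
  rw [Matrix.transpose_mul, Matrix.diagonal_transpose, ← diagonal_sqrt_mul_self hx]
  simp only [Matrix.mul_assoc]

theorem posSemidef_wsum {n m : ℕ} (v : Fin n → Fin m → ℝ) {x : Fin n → ℝ} (hx : ∀ i, 0 ≤ x i) :
    (wsum v x).PosSemidef := by
  rw [wsum_eq, ← mul_diagonal_sqrt_mul_transpose hx]
  simpa using Matrix.posSemidef_self_mul_conjTranspose
    (colMatrix v * Matrix.diagonal fun i => √(x i))

/-- Spreading over all `d` places changes nothing: entries can only grow, yet the total is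
unchanged. -/
theorem spreadSum_self {d : ℕ} (hd : 1 ≤ d) (lam : ℝ) {β : ℕ → ℝ} (hβ : IsSpectrum d β) :
    spreadSum d d lam β = ∑ i ∈ Finset.range d, 1 / (β i + lam) := by
  have h := (Finset.sum_eq_sum_iff_of_le fun i hi =>
    le_spread hd le_rfl hβ (Finset.mem_range.1 hi)).1 (sum_spread_eq hd le_rfl hβ).symm
  exact Finset.sum_congr rfl fun i hi => by rw [h i hi]

theorem trace_inv_add_smul_one {d : ℕ} {lam : ℝ} (hlam : 0 < lam) {X : Matrix (Fin d) (Fin d) ℝ}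
    (hX : X.PosSemidef) :
    ((X + lam • (1 : Matrix (Fin d) (Fin d) ℝ))⁻¹).trace =
      ∑ i ∈ Finset.range d, 1 / (eig X i + lam) := by
  obtain ⟨Q, hQ, h⟩ := exists_orthogonal_diagonalization hX.1
  have hQ' : Q * Q.transpose = 1 := mul_eq_one_comm.1 hQ
  have hsum : X + lam • (1 : Matrix (Fin d) (Fin d) ℝ) =
      Q * Matrix.diagonal (fun i : Fin d => eig X i + lam) * Q.transpose := by
    rw [← Matrix.diagonal_add, Matrix.mul_add, Matrix.add_mul, ← h, ← Matrix.smul_one_eq_diagonal,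
      Matrix.mul_smul, Matrix.mul_one, Matrix.smul_mul, hQ']
  have hinv : (X + lam • (1 : Matrix (Fin d) (Fin d) ℝ))⁻¹ =
      Q * Matrix.diagonal (fun i : Fin d => 1 / (eig X i + lam)) * Q.transpose := by
    refine Matrix.inv_eq_right_inv ?_
    rw [hsum]
    calc _ = Q * (Matrix.diagonal (fun i : Fin d => eig X i + lam) * (Q.transpose * Q) *
          Matrix.diagonal (fun i : Fin d => 1 / (eig X i + lam))) * Q.transpose := by
          simp only [Matrix.mul_assoc]
      _ = Q * 1 * Q.transpose := by
          rw [hQ, Matrix.mul_one, Matrix.diagonal_mul_diagonal, ← Matrix.diagonal_one]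
          congr 3
          funext i
          exact mul_one_div_cancel (add_pos_of_nonneg_of_pos (eig_nonneg hX i) hlam).ne'
      _ = 1 := by rw [Matrix.mul_one, hQ']
  rw [hinv, Matrix.trace_mul_comm, ← Matrix.mul_assoc, hQ, Matrix.one_mul, Matrix.trace_diagonal,
    Finset.sum_range]

theorem objC_eq {d n : ℕ} (hd : 1 ≤ d) (a : Fin n → Fin d → ℝ) {lam : ℝ} (hlam : 0 < lam)
    {x : Fin n → ℝ} (hx : ∀ i, 0 ≤ x i) :
    objC a lam x = spreadSum d d lam (eig (wsum a x)) := by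
  have h := posSemidef_wsum a hx
  rw [objC, trace_inv_add_smul_one hlam h, spreadSum_self hd lam (isSpectrum_eig h)]

theorem objN_eq {d n k : ℕ} (hd : 1 ≤ d) (hk : 1 ≤ k) (a : Fin n → Fin d → ℝ) {lam : ℝ}
    (hlam : 0 < lam) {x : Fin n → ℝ} (hx : ∀ i, 0 ≤ x i) :
    objN a lam k x = spreadSum d (min k d) lam (eig (wsum a x)) +
      ((d : ℝ) - (min k d : ℕ)) / lam := by
  rw [objN, convGam_eq_spreadSum hd hk hlam (posSemidef_wsum a hx)]

/-- The left side minus the constant is convex and lies below Γ, since each of the d - min(k, d)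
omitted terms is at most 1/λ. The envelope dominates every such function. -/
theorem spreadSum_self_le {d k : ℕ} (hd : 1 ≤ d) (hk : 1 ≤ k) {lam : ℝ} (hlam : 0 < lam)
    {X : Matrix (Fin d) (Fin d) ℝ} (hX : X.PosSemidef) :
    spreadSum d d lam (eig X) ≤
      spreadSum d (min k d) lam (eig X) + ((d : ℝ) - (min k d : ℕ)) / lam := by
  have hrd := min_le_right k d
  have hconv : ConvexOn ℝ (psdCone d)
      fun Y => spreadSum d d lam (eig Y) + -(((d : ℝ) - (min k d : ℕ)) / lam) :=
    (convexOn_spreadSum hd le_rfl hlam).add (convexOn_const _ (convex_psdCone d))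
  have := le_spreadSum_of_convexOn_of_le_Gam hd hk hlam hconv (fun Y hY => ?_) hX
  · linarith
  · have hY' : Y.PosSemidef := hY
    rw [spreadSum_self hd lam (isSpectrum_eig hY'), Gam, ← Finset.sum_range_add_sum_Ico _ hrd]
    have : ∑ i ∈ Finset.Ico (min k d) d, 1 / (eig Y i + lam) ≤
        ∑ i ∈ Finset.Ico (min k d) d, 1 / lam :=
      Finset.sum_le_sum fun i _ =>
        one_div_le_one_div_of_le hlam (le_add_of_nonneg_left (eig_nonneg hY' i))
    rw [Finset.sum_const, Nat.card_Ico, nsmul_eq_mul, Nat.cast_sub hrd, mul_one_div] at this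
    linarith

/-! ### Comparison with the relaxation through H -/

section Factor

variable {d n k : ℕ} {lam : ℝ} {a : Fin n → Fin d → ℝ} {H : Matrix (Fin n) (Fin n) ℝ}
  {x : Fin n → ℝ}

/-- The weighted spectrum of `∑ x_i h_i h_iᵀ` dominates that of `∑ x_i a_i a_iᵀ` shifted by `λ`
in the first `k` places. -/
theorem sum_mul_eig_wsum_le (hdn : d ≤ n) (hkn : k ≤ n) (hlam : 0 < lam)
    (hH : H.transpose * H = covMatrix a lam) (hx : x ∈ feasible n k) {w : ℕ → ℝ}
    (hw : Monotone w) :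
    ∑ i ∈ Finset.range d, w i * eig (wsum a x) i + lam * ∑ i ∈ Finset.range k, w i ≤
      ∑ i ∈ Finset.range n, w i * eig (wsum (fun i j => H j i) x) i := by
  have hx0 : ∀ i, 0 ≤ x i := fun i => (hx.1 i).1
  set S : Matrix (Fin n) (Fin n) ℝ := Matrix.diagonal fun i => √(x i) with hS
  set Z := colMatrix a * S with hZ
  have hSS : S * S = Matrix.diagonal x := diagonal_sqrt_mul_self hx0
  have hST : S.transpose = S := Matrix.diagonal_transpose _
  set W := Z.transpose * Z + lam • Matrix.diagonal x with hWdef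
  have hHW : (H * S).transpose * (H * S) = W := by
    calc (H * S).transpose * (H * S) = S * (H.transpose * H) * S := by
          rw [Matrix.transpose_mul, hST]
          simp only [Matrix.mul_assoc]
      _ = W := by
          rw [hH, covMatrix, hWdef, hZ, Matrix.transpose_mul, hST, ← hSS]
          simp only [Matrix.mul_add, Matrix.add_mul, Matrix.mul_smul, Matrix.smul_mul,
            Matrix.mul_one, Matrix.mul_assoc]
  have hW : W.PosSemidef := by
    rw [← hHW]
    simpa using Matrix.posSemidef_conjTranspose_mul_self (H * S)
  have e1 : ∀ i < n, eig (wsum (fun i j => H j i) x) i = eig W i := by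
    intro i hi
    rw [← hHW, eig_transpose_mul_self le_rfl _ hi, wsum_eq, mul_diagonal_sqrt_mul_transpose hx0]
    rfl
  have e2 : ∀ i < n, eig (wsum a x) i = eig (Z.transpose * Z) i := by
    intro i hi
    rw [eig_transpose_mul_self hdn _ hi, wsum_eq, mul_diagonal_sqrt_mul_transpose hx0]
  have e3 : ∑ i ∈ Finset.range d, w i * eig (wsum a x) i =
      ∑ i : Fin n, w i * eig (Z.transpose * Z) i := by
    rw [Fin.sum_univ_eq_sum_range (fun i => w i * eig (Z.transpose * Z) i) n,
      ← Finset.sum_range_add_sum_Ico _ hdn, Finset.sum_eq_zero (s := Finset.Ico d n), add_zero]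
    · exact Finset.sum_congr rfl fun i hi => by
        rw [e2 i ((Finset.mem_range.1 hi).trans_le hdn)]
    · intro i hi
      obtain ⟨hi1, hi2⟩ := Finset.mem_Ico.1 hi
      rw [← e2 i hi2, eig_of_le _ hi1, mul_zero]
  -- In an eigenbasis of `W` the diagonals of the two summands can be bounded separately.
  obtain ⟨Q, hQ, h⟩ := exists_orthogonal_diagonalization hW.1
  have hQ' : Q * Q.transpose = 1 := mul_eq_one_comm.1 hQ
  have hZZ : (Z.transpose * Z).PosSemidef := by
    simpa using Matrix.posSemidef_conjTranspose_mul_self Z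
  have b1 := sum_mul_eig_le hZZ.1 hQ hw
  have hD : (Matrix.diagonal x).PosSemidef := Matrix.PosSemidef.diagonal hx0
  have hD1 : (1 - Matrix.diagonal x).PosSemidef := by
    rw [← Matrix.diagonal_one, Matrix.diagonal_sub]
    exact Matrix.PosSemidef.diagonal fun i => sub_nonneg.2 (hx.1 i).2
  -- Conjugation keeps 0 ≤ diag(x) ≤ 1 and the trace `k`, so the new diagonal is again a feasible
  -- vector.
  have b2 : ∑ i ∈ Finset.range k, w i ≤
      ∑ i : Fin n, w i * (Q.transpose * Matrix.diagonal x * Q) i i := by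
    refine sum_range_le_sum_mul hkn hw (fun i => diag_conj_nonneg hD Q i) (fun i => ?_) ?_
    · have := diag_conj_nonneg hD1 Q i
      rw [Matrix.mul_sub, Matrix.sub_mul, Matrix.mul_one, hQ, Matrix.sub_apply,
        Matrix.one_apply_eq] at this
      linarith
    · change (Q.transpose * Matrix.diagonal x * Q).trace = k
      rw [Matrix.trace_mul_comm, ← Matrix.mul_assoc, hQ', Matrix.one_mul, Matrix.trace_diagonal,
        hx.2]
  have e4 : ∑ i ∈ Finset.range n, w i * eig (wsum (fun i j => H j i) x) i =
      ∑ i : Fin n, w i * (Q.transpose * (Z.transpose * Z) * Q) i i +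
        lam * ∑ i : Fin n, w i * (Q.transpose * Matrix.diagonal x * Q) i i := by
    rw [Finset.sum_range, Finset.mul_sum, ← Finset.sum_add_distrib]
    refine Finset.sum_congr rfl fun i _ => ?_
    rw [e1 i i.2, ← eig_eq_diag_conj hQ h i, hWdef, Matrix.mul_add, Matrix.add_mul,
      Matrix.mul_smul, Matrix.smul_mul, Matrix.add_apply, Matrix.smul_apply, smul_eq_mul]
    ring
  rw [e3, e4]
  exact add_le_add b1 (mul_le_mul_of_nonneg_left b2 hlam.le)

/-- Needed because Φ has no shift λ to keep its denominators positive. -/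
theorem spread_wsum_factor_pos (hdn : d ≤ n) (hk : 1 ≤ k) (hkn : k ≤ n) (hlam : 0 < lam)
    (hH : H.transpose * H = covMatrix a lam) (hx : x ∈ feasible n k) (i : ℕ) :
    0 < spread n k (eig (wsum (fun i j => H j i) x)) i := by
  have hx0 : ∀ i, 0 ≤ x i := fun i => (hx.1 i).1
  refine spread_pos hk hkn (isSpectrum_eig (posSemidef_wsum _ hx0)) (hlam.trans_le ?_) i
  -- For these weights the domination inequality bounds the eigenvalue sum from index `k - 1` on
  -- below by λ.
  let w : ℕ → ℝ := fun i => if i < k - 1 then 0 else 1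
  have hw : Monotone w := by
    intro i j hij
    simp only [w]
    split_ifs <;> first | omega | norm_num
  have hw0 : ∀ i, 0 ≤ w i := fun i => by
    simp only [w]
    split_ifs <;> norm_num
  have key := sum_mul_eig_wsum_le hdn hkn hlam hH hx hw
  have h1 : 0 ≤ ∑ i ∈ Finset.range d, w i * eig (wsum a x) i :=
    Finset.sum_nonneg fun i _ => mul_nonneg (hw0 i) (eig_nonneg (posSemidef_wsum a hx0) i)
  have h2 : 1 ≤ ∑ i ∈ Finset.range k, w i := by
    have := Finset.single_le_sum (f := w) (fun i _ => hw0 i)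
      (Finset.mem_range.2 (show k - 1 < k by omega))
    simpa [w] using this
  have h3 : ∑ i ∈ Finset.range n, w i * eig (wsum (fun i j => H j i) x) i =
      ∑ i ∈ Finset.Ico (k - 1) n, eig (wsum (fun i j => H j i) x) i := by
    rw [← Finset.sum_range_add_sum_Ico _ (show k - 1 ≤ n by omega), Finset.sum_eq_zero, zero_add]
    · exact Finset.sum_congr rfl fun i hi => by simp [w, not_lt.2 (Finset.mem_Ico.1 hi).1]
    · intro i hi
      simp [w, Finset.mem_range.1 hi]
  rw [← h3]
  nlinarith

theorem objM_eq (hk : 1 ≤ k) (hkn : k ≤ n) (hx : x ∈ feasible n k) :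
    objM d H lam k x =
      spreadSum n k 0 (eig (wsum (fun i j => H j i) x)) + ((d : ℝ) - k) / lam := by
  rw [objM, Phi, phi_eq_spreadSum hk hkn
    (isSpectrum_eig (posSemidef_wsum _ fun i => (hx.1 i).1))]

/-- Write Φ through its own supporting functional, bound the weighted spectrum below, and apply the
tangents of 1/t at the spread of β: at the shifted spread of σ for the first min(k, d) indices, and
at λ for the rest. The latter account for the difference of the two constants. -/
theorem objM_le_objN (hd : 1 ≤ d) (hdn : d ≤ n) (hk : 1 ≤ k) (hkn : k ≤ n) (hlam : 0 < lam)
    (hH : H.transpose * H = covMatrix a lam) (hx : x ∈ feasible n k) :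
    objM d H lam k x ≤ objN a lam k x := by
  have hx0 : ∀ i, 0 ≤ x i := fun i => (hx.1 i).1
  have hβ := isSpectrum_eig (posSemidef_wsum (fun i j => H j i) hx0)
  have hσ := isSpectrum_eig (posSemidef_wsum a hx0)
  have hpos := spread_wsum_factor_pos hdn hk hkn hlam hH hx
  rw [objM_eq hk hkn hx, objN_eq hd hk a hlam hx0]
  set β := eig (wsum (fun i j => H j i) x)
  set σ := eig (wsum a x)
  have hpos' : ∀ i, 0 < spread n k β i + 0 := fun i => by simpa using hpos i
  have hr1 : 1 ≤ min k d := le_min hk hd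
  have hrd := min_le_right k d
  have hrk := min_le_left k d
  set r := min k d
  have hw := slope_monotone hk hkn hβ hpos'
  set w := slope n k 0 β
  have h1 := sum_mul_eig_wsum_le hdn hkn hlam hH hx hw
  have h2 := sum_mul_spread_le hr1 hrd hσ hw
  have hwi : ∀ i, w i = 1 / spread n k β i ^ 2 := fun i => by simp [w, slope]
  have h3 : intercept n k 0 β = ∑ i ∈ Finset.range k, 2 / spread n k β i := by
    simp [intercept]
  have h4 : ∑ i ∈ Finset.range r, 2 / spread n k β i ≤
      ∑ i ∈ Finset.range r, 1 / (spread d r σ i + lam) +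
        (∑ i ∈ Finset.range r, w i * spread d r σ i + lam * ∑ i ∈ Finset.range r, w i) := by
    rw [Finset.mul_sum, ← Finset.sum_add_distrib, ← Finset.sum_add_distrib]
    refine Finset.sum_le_sum fun i _ => ?_
    have := tangent_le_one_div (hpos i)
      (add_pos_of_nonneg_of_pos (spread_nonneg hr1 hrd hσ i) hlam)
    rw [← hwi] at this
    linarith
  have h5 : ∑ i ∈ Finset.Ico r k, 2 / spread n k β i ≤
      ((k : ℝ) - r) / lam + lam * ∑ i ∈ Finset.Ico r k, w i := by
    have : ((k : ℝ) - r) / lam = ∑ i ∈ Finset.Ico r k, 1 / lam := by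
      rw [Finset.sum_const, Nat.card_Ico, nsmul_eq_mul, Nat.cast_sub hrk, mul_one_div]
    rw [this, Finset.mul_sum, ← Finset.sum_add_distrib]
    refine Finset.sum_le_sum fun i _ => ?_
    have := tangent_le_one_div (hpos i) hlam
    rw [← hwi] at this
    linarith
  rw [spreadSum_eq hk hkn hβ hpos', h3]
  rw [← Finset.sum_range_add_sum_Ico _ hrk] at h1 ⊢
  have h6 : ((d : ℝ) - r) / lam - ((d : ℝ) - k) / lam = ((k : ℝ) - r) / lam := by ring
  change _ - ∑ i ∈ Finset.range n, w i * β i + _ ≤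
    ∑ i ∈ Finset.range r, 1 / (spread d r σ i + lam) + _
  linarith

end Factor

end RAOD

/-! ### The theorem -/

theorem theorem4 (d n k : ℕ) (hd : 1 ≤ d) (hdn : d ≤ n) (hk : 1 ≤ k) (hkn : k ≤ n)
    (lam : ℝ) (hlam : 0 < lam) (a : Fin n → Fin d → ℝ) :
    -- the minima that define the first two values are attained
    IsLeast (RAOD.objC a lam '' RAOD.feasible n k) (RAOD.nuC a lam k) ∧
    IsLeast (RAOD.objN a lam k '' RAOD.feasible n k) (RAOD.nuN a lam k) ∧
    -- (i)
    (d ≤ k → RAOD.nuN a lam k = RAOD.nuC a lam k) ∧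
    -- (ii)
    (k < d → RAOD.nuC a lam k ≤ RAOD.nuN a lam k) ∧
    -- (iii), with attainment, for every factorization `C = Hᵀ H`
    (∀ H : Matrix (Fin n) (Fin n) ℝ, H.transpose * H = RAOD.covMatrix a lam →
      IsLeast (RAOD.objM d H lam k '' RAOD.feasible n k) (RAOD.nuM d H lam k) ∧
      RAOD.nuM d H lam k ≤ RAOD.nuN a lam k) := by
  open RAOD in
  have hx0 : ∀ x ∈ feasible n k, ∀ i, 0 ≤ x i := fun x hx i => (hx.1 i).1
  have hr1 : 1 ≤ min k d := le_min hk hd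
  have hrd := min_le_right k d
  have hC : IsLeast (objC a lam '' feasible n k) (nuC a lam k) := by
    refine isLeast_image_feasible hk hkn a fun z hz => ?_
    have hz' := posSemidef_wsum a (hx0 z hz)
    obtain ⟨L, c, h1, h2⟩ :=
      exists_affine_le_spreadSum hd le_rfl hz' (spread_add_pos hd le_rfl hlam hz')
    refine ⟨L, c, by rw [objC_eq hd a hlam (hx0 z hz), h1], fun x hx => ?_⟩
    have hx' := posSemidef_wsum a (hx0 x hx)
    rw [objC_eq hd a hlam (hx0 x hx)]
    exact h2 _ hx' (spread_add_pos hd le_rfl hlam hx')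
  have hN : IsLeast (objN a lam k '' feasible n k) (nuN a lam k) := by
    refine isLeast_image_feasible hk hkn a fun z hz => ?_
    have hz' := posSemidef_wsum a (hx0 z hz)
    obtain ⟨L, c, h1, h2⟩ :=
      exists_affine_le_spreadSum hr1 hrd hz' (spread_add_pos hr1 hrd hlam hz')
    refine ⟨L, c + ((d : ℝ) - (min k d : ℕ)) / lam, ?_, fun x hx => ?_⟩
    · rw [objN_eq hd hk a hlam (hx0 z hz), h1]
      ring
    · have hx' := posSemidef_wsum a (hx0 x hx)
      rw [objN_eq hd hk a hlam (hx0 x hx)]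
      linarith [h2 _ hx' (spread_add_pos hr1 hrd hlam hx')]
  refine ⟨hC, hN, fun hdk => ?_, fun _ => ?_, fun H hH => ?_⟩
  · rw [nuN, nuC]
    congr 1
    refine Set.image_congr fun x hx => ?_
    rw [objN_eq hd hk a hlam (hx0 x hx), objC_eq hd a hlam (hx0 x hx), min_eq_right hdk]
    simp
  · obtain ⟨x, hx, hxN⟩ := hN.1
    rw [← hxN]
    refine (hC.2 (Set.mem_image_of_mem _ hx)).trans ?_
    rw [objN_eq hd hk a hlam (hx0 x hx), objC_eq hd a hlam (hx0 x hx)]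
    exact spreadSum_self_le hd hk hlam (posSemidef_wsum a (hx0 x hx))
  · have hM : IsLeast (objM d H lam k '' feasible n k) (nuM d H lam k) := by
      refine isLeast_image_feasible hk hkn (fun i j => H j i) fun z hz => ?_
      have hp : ∀ x ∈ feasible n k, ∀ i,
          0 < spread n k (eig (wsum (fun i j => H j i) x)) i + 0 := fun x hx i => by
        simpa using spread_wsum_factor_pos hdn hk hkn hlam hH hx i
      obtain ⟨L, c, h1, h2⟩ := exists_affine_le_spreadSum hk hkn
        (posSemidef_wsum (fun i j => H j i) (hx0 z hz)) (hp z hz)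
      refine ⟨L, c + ((d : ℝ) - k) / lam, ?_, fun x hx => ?_⟩
      · rw [objM_eq hk hkn hz, h1]
        ring
      · rw [objM_eq hk hkn hx]
        linarith [h2 _ (posSemidef_wsum _ (hx0 x hx)) (hp x hx)]
    refine ⟨hM, ?_⟩
    obtain ⟨x, hx, hxN⟩ := hN.1
    rw [← hxN]
    exact (hM.2 (Set.mem_image_of_mem _ hx)).trans (objM_le_objN hd hdn hk hkn hlam hH hx)
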